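/- Let $\alpha\in(0,1)$ be irrational with regular continued fraction expansion $\alpha=1/(a_1+1/(a_2+1/(a_3+\cdots)))$. Let $p_n,q_n$ ($n\ge1$) be given by $p_1=0$, $p_2=1$, $q_1=1$, $q_2=a_1$ and $p_{n+1}=a_np_n+p_{n-1}$, $q_{n+1}=a_nq_n+q_{n-1}$ for $n\ge2$, and put $\alpha_n=|q_n\alpha-p_n|$. Let $Z_\alpha=\prod_{n=1}^\infty\{0,1,\dots,a_n\}$ and let $$\mathcal V_\alpha=\Big\{x\in(0,1)\ :\ \text{there is exactly one } (x_1,x_2,\dots)\in Z_\alpha \text{ with } x=\sum_{n=1}^\infty x_n\alpha_n\Big\}.$$ Put $n_0=\sup\{n\ge1: a_n=1\}\in\{0,1,2,\dots\}\cup\{\infty\}$, with $n_0=0$ if no $a_n$ equals $1$. If $n_0<\infty$ and $$\liminf_{n\to+\infty}\frac{\sum_{k=n_0+1}^n\log(a_k-1)}{\sum_{k=n_0+1}^n\log(a_k+1)}>0,$$ then the Hausdorff dimension of $\mathcal V_\alpha$ is positive: $\dim_H(\mathcal V_\alpha)>0$. -/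

import Mathlib

noncomputable section

namespace RotationalExpansion

/-- The partial quotient `a_n` (`n ≥ 1`) of the regular continued fraction
`α = 1 / (a_1 + 1 / (a_2 + ⋯))` of `α ∈ (0, 1)`. Mathlib lists the partial quotients of the
fractional part starting from index `0`. The default value `0` only occurs after the expansion has
terminated, hence never for irrational `α`; the value at `n = 0` carries no meaning. -/
def partialQuotient (α : ℝ) (n : ℕ) : ℝ :=
  ((GenContFract.of α).partDens.get? (n - 1)).getD 0

/-- The numerator `p_n` (`n ≥ 1`) of the convergents of `α ∈ (0, 1)`, indexed so that
`p_1 = 0`, `p_2 = 1`, `p_{n+1} = a_n p_n + p_{n-1}`. -/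
def convNum (α : ℝ) (n : ℕ) : ℝ := (GenContFract.of α).nums (n - 1)

/-- The denominator `q_n` (`n ≥ 1`) of the convergents of `α ∈ (0, 1)`, indexed so that
`q_1 = 1`, `q_2 = a_1`, `q_{n+1} = a_n q_n + q_{n-1}`. -/
def convDen (α : ℝ) (n : ℕ) : ℝ := (GenContFract.of α).dens (n - 1)

/-- The base `α_n = |q_n α - p_n|` (`n ≥ 1`) of the rotational expansions. -/
def base (α : ℝ) (n : ℕ) : ℝ := |convDen α n * α - convNum α n|

/-- The space `Z_α = ∏_{n ≥ 1} {0, 1, …, a_n}` of digit sequences `(x_1, x_2, …)`; the entry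
`d n` is the digit `x_{n+1}`. -/
def digitSpace (α : ℝ) : Set (ℕ → ℕ) :=
  {d | ∀ n, (d n : ℝ) ≤ partialQuotient α (n + 1)}

/-- The digit sequence `(x_1, x_2, …) ∈ Z_α` represents `x = ∑_{n ≥ 1} x_n α_n`. -/
def Represents (α : ℝ) (d : ℕ → ℕ) (x : ℝ) : Prop :=
  d ∈ digitSpace α ∧ HasSum (fun n : ℕ => (d n : ℝ) * base α (n + 1)) x

/-- The set `V_α` of all `x ∈ (0, 1)` with exactly one rotational expansion in `Z_α`. -/
def uniqueSet (α : ℝ) : Set ℝ :=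
  {x | x ∈ Set.Ioo (0 : ℝ) 1 ∧ ∃! d : ℕ → ℕ, Represents α d x}

/-- `n_0 = sup {n ≥ 1 : a_n = 1}`, an element of `{0, 1, 2, …, ∞}`; it is `0` if no partial
quotient equals `1`. -/
def lastOne (α : ℝ) : ℕ∞ :=
  ⨆ n ∈ {n : ℕ | 1 ≤ n ∧ partialQuotient α n = 1}, (n : ℕ∞)

end RotationalExpansion

end

/-! The bases satisfy `β k = a k * β (k + 1) + β (k + 2)`. Take digits that vanish up to `n₀` and
lie in `[1, a k - 1]` afterwards. From `n₀` on, each tail of such an expansion lies strictly between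
two consecutive bases, so no change of an earlier digit can be compensated: the sum has a unique
expansion (`digits_unique_of_mem_Icc`).

These sums form a Cantor set, parametrized by `z ∈ [0, 1)` through the Cantor series with radices `a
k - 1`. Points sharing `n` digits are about `β n` apart, while their parameters are about `1 /
wordCount a n` apart. Hence the inverse parametrization is `s`-Hölder as soon as `wordCount a n * β
n ^ s` is bounded below (`abs_sub_le_rpow`); it maps onto `[0, 1)`, so the Cantor set has dimension
at least `s`. Since `β n ≥ β 0 / ∏ (a k + 1)`, the liminf hypothesis supplies such an `s > 0`
(`exists_holder_const`). -/

namespace RotationalExpansion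

/-! ### Euclidean recurrences and uniqueness of digits -/

/-- A sequence of positive reals `β` driven by the digit bounds `a` through the Euclidean
recurrence `β k = a k * β (k + 1) + β (k + 2)`. -/
structure IsEuclidean (a : ℕ → ℕ) (β : ℕ → ℝ) : Prop where
  one_le : ∀ k, 1 ≤ a k
  pos : ∀ k, 0 < β k
  rec_eq : ∀ k, β k = a k * β (k + 1) + β (k + 2)

namespace IsEuclidean

variable {a : ℕ → ℕ} {β : ℕ → ℝ}

theorem shift (h : IsEuclidean a β) (n : ℕ) :
    IsEuclidean (fun k => a (k + n)) (fun k => β (k + n)) where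
  one_le k := h.one_le _
  pos k := h.pos _
  rec_eq k := by
    have := h.rec_eq (k + n)
    rwa [show k + n + 1 = k + 1 + n by ring, show k + n + 2 = k + 2 + n by ring] at this

theorem mul_le (h : IsEuclidean a β) (k : ℕ) : a k * β (k + 1) ≤ β k := by
  rw [h.rec_eq k]; linarith [h.pos (k + 2)]

theorem antitone (h : IsEuclidean a β) : Antitone β := by
  refine antitone_nat_of_succ_le fun k => le_trans ?_ (h.mul_le k)
  have : (1 : ℝ) ≤ a k := by exact_mod_cast h.one_le k
  nlinarith [h.pos (k + 1)]

theorem le_add_one_mul (h : IsEuclidean a β) (k : ℕ) : β k ≤ (a k + 1) * β (k + 1) := by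
  rw [h.rec_eq k]; linarith [h.antitone (Nat.le_succ (k + 1))]

/-- Telescoping: each term is `β k - β (k + 2)`. This bounds every admissible sum by `β 0 + β 1`. -/
theorem sum_range (h : IsEuclidean a β) (n : ℕ) :
    ∑ k ∈ Finset.range n, (a k : ℝ) * β (k + 1) = β 0 + β 1 - β n - β (n + 1) := by
  induction n with
  | zero => simp
  | succ n ih => rw [Finset.sum_range_succ, ih]; linarith [h.rec_eq n]

variable {d e : ℕ → ℕ}

theorem sum_range_le (h : IsEuclidean a β) (hd : ∀ k, d k ≤ a k) (n : ℕ) :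
    ∑ k ∈ Finset.range n, (d k : ℝ) * β (k + 1) ≤ β 0 + β 1 := by
  calc _ ≤ ∑ k ∈ Finset.range n, (a k : ℝ) * β (k + 1) := by
        gcongr with k _
        · exact (h.pos _).le
        · exact hd k
    _ ≤ _ := by rw [h.sum_range]; linarith [h.pos n, h.pos (n + 1)]

theorem term_nonneg (h : IsEuclidean a β) (d : ℕ → ℕ) (k : ℕ) : 0 ≤ (d k : ℝ) * β (k + 1) :=
  mul_nonneg (Nat.cast_nonneg _) (h.pos _).le

theorem summable (h : IsEuclidean a β) (hd : ∀ k, d k ≤ a k) :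
    Summable fun k => (d k : ℝ) * β (k + 1) :=
  summable_of_sum_range_le (h.term_nonneg d) (h.sum_range_le hd)

theorem tsum_le (h : IsEuclidean a β) (hd : ∀ k, d k ≤ a k) :
    ∑' k, (d k : ℝ) * β (k + 1) ≤ β 0 + β 1 :=
  Real.tsum_le_of_sum_range_le (h.term_nonneg d) (h.sum_range_le hd)

theorem lt_tsum (h : IsEuclidean a β) (hd : ∀ k, d k ≤ a k) (hd1 : ∀ k, 1 ≤ d k) :
    β 1 < ∑' k, (d k : ℝ) * β (k + 1) := by
  have h1 := (h.summable hd).sum_le_tsum (Finset.range 2) fun k _ => h.term_nonneg d k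
  have h2 : (1 : ℝ) ≤ d 0 := by exact_mod_cast hd1 0
  have h3 : (1 : ℝ) ≤ d 1 := by exact_mod_cast hd1 1
  simp only [Finset.sum_range_succ, Finset.sum_range_zero, zero_add] at h1
  norm_num at h1
  nlinarith [h.pos 1, h.pos 2]

/-- Raising every digit by one keeps the sequence admissible, so the total stays at most `β 0 + β
1`; the added all-ones sum alone exceeds `β 1`. -/
theorem tsum_lt (h : IsEuclidean a β) (hd : ∀ k, d k + 1 ≤ a k) :
    ∑' k, (d k : ℝ) * β (k + 1) < β 0 := by
  have h1 := h.tsum_le hd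
  have h2 := h.lt_tsum (d := fun _ => 1) h.one_le fun _ => le_rfl
  have h3 := (h.summable fun k => (Nat.le_succ _).trans (hd k)).tsum_add
    (h.summable (d := fun _ => 1) h.one_le)
  have h4 : ∀ k, ((d k + 1 : ℕ) : ℝ) * β (k + 1) =
      (d k : ℝ) * β (k + 1) + ((1 : ℕ) : ℝ) * β (k + 1) := fun k => by push_cast; ring
  simp only [h4] at h1
  linarith

theorem tsum_eq_sum_add (h : IsEuclidean a β) (hd : ∀ k, d k ≤ a k) (n : ℕ) :
    ∑' k, (d k : ℝ) * β (k + 1) =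
      ∑ k ∈ Finset.range n, (d k : ℝ) * β (k + 1) + ∑' k, (d (k + n) : ℝ) * β (k + n + 1) :=
  ((h.summable hd).sum_add_tsum_nat_add n).symm

theorem tail_le (h : IsEuclidean a β) (hd : ∀ k, d k ≤ a k) (n : ℕ) :
    ∑' k, (d (k + n) : ℝ) * β (k + n + 1) ≤ β n + β (n + 1) := by
  have := (h.shift n).tsum_le (d := fun k => d (k + n)) fun k => hd _
  simpa only [add_right_comm _ 1 n, zero_add, add_comm 1 n] using this

theorem tail_lt (h : IsEuclidean a β) (n : ℕ) (hd : ∀ k, n ≤ k → d k + 1 ≤ a k) :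
    ∑' k, (d (k + n) : ℝ) * β (k + n + 1) < β n := by
  have := (h.shift n).tsum_lt (d := fun k => d (k + n)) fun k => hd _ (by omega)
  simpa only [add_right_comm _ 1 n, zero_add, add_comm 1 n] using this

theorem lt_tail (h : IsEuclidean a β) (hd : ∀ k, d k ≤ a k) (n : ℕ)
    (hd1 : ∀ k, n ≤ k → 1 ≤ d k) :
    β (n + 1) < ∑' k, (d (k + n) : ℝ) * β (k + n + 1) := by
  have := (h.shift n).lt_tsum (d := fun k => d (k + n)) (fun k => hd _)
    fun k => hd1 _ (by omega)
  simpa only [add_right_comm _ 1 n, zero_add, add_comm 1 n] using this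

/-- A digit sequence is determined by its sum if every tail avoids the ranges reachable after
changing the preceding digit. -/
theorem digits_unique (h : IsEuclidean a β) (hd : ∀ k, d k ≤ a k) (he : ∀ k, e k ≤ a k)
    (hu : ∀ n, ∑' k, (d (k + (n + 1)) : ℝ) * β (k + (n + 1) + 1) < β (n + 1))
    (hl : ∀ n, 1 ≤ d n → β (n + 2) < ∑' k, (d (k + (n + 1)) : ℝ) * β (k + (n + 1) + 1))
    (heq : ∑' k, (e k : ℝ) * β (k + 1) = ∑' k, (d k : ℝ) * β (k + 1)) : e = d := by
  funext n
  induction n using Nat.strong_induction_on with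
  | _ n ih =>
    rw [h.tsum_eq_sum_add hd (n + 1), h.tsum_eq_sum_add he (n + 1), Finset.sum_range_succ,
      Finset.sum_range_succ,
      Finset.sum_congr rfl fun k hk => by rw [ih k (Finset.mem_range.1 hk)]] at heq
    have hp := h.pos (n + 1)
    have h0 : 0 ≤ ∑' k, (e (k + (n + 1)) : ℝ) * β (k + (n + 1) + 1) :=
      tsum_nonneg fun k => h.term_nonneg e _
    -- At the first disagreement the digit gap is worth at least `β (n + 1)`. A smaller `e n` would
    -- need a tail above `β (n + 1) + β (n + 2)`; a larger one would need the tail of `d` to reach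
    -- `β (n + 1)`.
    rcases lt_trichotomy (e n) (d n) with hlt | heqn | hgt
    · have h1 := hl n (by omega)
      have h2 := h.tail_le he (n + 1)
      have h3 : (e n : ℝ) + 1 ≤ d n := by exact_mod_cast hlt
      nlinarith
    · exact heqn
    · have h1 := hu n
      have h3 : (d n : ℝ) + 1 ≤ e n := by exact_mod_cast hgt
      nlinarith

/-- Digit sequences vanishing before `n` and with digits in `[1, a k - 1]` from `n` on are
determined by their sum. -/
theorem digits_unique_of_mem_Icc (h : IsEuclidean a β) (n : ℕ) (hd0 : ∀ k < n, d k = 0)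
    (hd1 : ∀ k, n ≤ k → 1 ≤ d k ∧ d k + 1 ≤ a k) (he : ∀ k, e k ≤ a k)
    (heq : ∑' k, (e k : ℝ) * β (k + 1) = ∑' k, (d k : ℝ) * β (k + 1)) : e = d := by
  have hd : ∀ k, d k ≤ a k := fun k => by
    rcases lt_or_ge k n with hk | hk
    · simp [hd0 k hk]
    · exact (Nat.le_succ _).trans (hd1 k hk).2
  have tail_zero : ∀ m, m ≤ n → ∑' k, (d (k + m) : ℝ) * β (k + m + 1) =
      ∑' k, (d (k + n) : ℝ) * β (k + n + 1) := fun m hm => by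
    have h1 := h.tsum_eq_sum_add hd m
    have h2 := h.tsum_eq_sum_add hd n
    rw [Finset.sum_eq_zero fun k hk => by
      simp [hd0 k ((Finset.mem_range.1 hk).trans_le hm)]] at h1
    rw [Finset.sum_eq_zero fun k hk => by simp [hd0 k (Finset.mem_range.1 hk)]] at h2
    linarith
  refine h.digits_unique hd he (fun m => ?_) (fun m hm => ?_) heq
  · rcases le_total (m + 1) n with hmn | hmn
    · rw [tail_zero _ hmn]
      exact (h.tail_lt n fun k hk => (hd1 k hk).2).trans_le (h.antitone hmn)
    · exact h.tail_lt _ fun k hk => (hd1 k (hmn.trans hk)).2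
  · have hmn : n ≤ m := by
      by_contra! hc
      simp [hd0 m hc] at hm
    exact h.lt_tail hd _ fun k hk => (hd1 k (by omega)).1

theorem mul_two_pow_le (h : IsEuclidean a β) (h2 : ∀ k, 2 ≤ a k) (n : ℕ) :
    β n ≤ β 0 * (1 / 2) ^ n := by
  induction n with
  | zero => simp
  | succ n ih =>
    have h1 := h.mul_le n
    have h3 : (2 : ℝ) ≤ a n := by exact_mod_cast h2 n
    rw [pow_succ]
    nlinarith [h.pos (n + 1)]

theorem tendsto_zero (h : IsEuclidean a β) (h2 : ∀ k, 2 ≤ a k) :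
    Filter.Tendsto β Filter.atTop (nhds 0) := by
  refine squeeze_zero (fun k => (h.pos k).le) (h.mul_two_pow_le h2) ?_
  simpa using (tendsto_pow_atTop_nhds_zero_of_lt_one (r := (1 / 2 : ℝ)) (by norm_num)
    (by norm_num)).const_mul (β 0)

end IsEuclidean

/-! ### Cantor series parametrization and Hölder estimate -/

/-- The number of words of length `n` with letters `1 ≤ d k ≤ a k - 1`. -/
def wordCount (a : ℕ → ℕ) (n : ℕ) : ℕ := ∏ k ∈ Finset.range n, (a k - 1)

/-- The digits in `[1, a k - 1]` of the Cantor series expansion of `z` with respect to the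
radices `a k - 1`. -/
noncomputable def cantorDigit (a : ℕ → ℕ) (z : ℝ) (n : ℕ) : ℕ :=
  (⌊(wordCount a (n + 1) : ℝ) * z⌋ - (a n - 1 : ℕ) * ⌊(wordCount a n : ℝ) * z⌋ + 1).toNat

section Cantor

variable {a : ℕ → ℕ} {β : ℕ → ℝ}

theorem wordCount_succ (a : ℕ → ℕ) (n : ℕ) :
    wordCount a (n + 1) = wordCount a n * (a n - 1) := Finset.prod_range_succ _ _

theorem wordCount_pos (h2 : ∀ k, 2 ≤ a k) (n : ℕ) : 0 < wordCount a n :=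
  Finset.prod_pos fun k _ => by have := h2 k; omega

theorem floor_sub_mem (h2 : ∀ k, 2 ≤ a k) (z : ℝ) (n : ℕ) :
    0 ≤ ⌊(wordCount a (n + 1) : ℝ) * z⌋ - (a n - 1 : ℕ) * ⌊(wordCount a n : ℝ) * z⌋ ∧
    ⌊(wordCount a (n + 1) : ℝ) * z⌋ - (a n - 1 : ℕ) * ⌊(wordCount a n : ℝ) * z⌋ <
      (a n - 1 : ℕ) := by
  have hw : (wordCount a (n + 1) : ℝ) * z = ((a n - 1 : ℕ) : ℝ) * (wordCount a n * z) := by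
    rw [wordCount_succ]; push_cast; ring
  have hpos : (0 : ℝ) < (a n - 1 : ℕ) := by have := h2 n; exact_mod_cast (by omega)
  rw [hw]
  set w := (wordCount a n : ℝ) * z
  constructor
  · rw [sub_nonneg, Int.le_floor]
    push_cast
    exact mul_le_mul_of_nonneg_left (Int.floor_le w) hpos.le
  · rw [sub_lt_iff_lt_add, Int.floor_lt]
    push_cast
    nlinarith [Int.lt_floor_add_one w]

theorem cantorDigit_cast (h2 : ∀ k, 2 ≤ a k) (z : ℝ) (n : ℕ) :
    (cantorDigit a z n : ℤ) =
      ⌊(wordCount a (n + 1) : ℝ) * z⌋ - (a n - 1 : ℕ) * ⌊(wordCount a n : ℝ) * z⌋ + 1 :=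
  Int.toNat_of_nonneg (by linarith [(floor_sub_mem h2 z n).1])

theorem one_le_cantorDigit (h2 : ∀ k, 2 ≤ a k) (z : ℝ) (n : ℕ) : 1 ≤ cantorDigit a z n := by
  have h1 := cantorDigit_cast h2 z n
  have h3 := (floor_sub_mem h2 z n).1
  omega

theorem cantorDigit_add_one_le (h2 : ∀ k, 2 ≤ a k) (z : ℝ) (n : ℕ) :
    cantorDigit a z n + 1 ≤ a n := by
  have h1 := cantorDigit_cast h2 z n
  have h3 := (floor_sub_mem h2 z n).2
  have h4 := h2 n
  omega

/-- The point `∑ d k * β (k + 1)` whose digits `d` are the Cantor series digits of `z`. -/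
noncomputable def cantorPoint (a : ℕ → ℕ) (β : ℕ → ℝ) (z : ℝ) : ℝ :=
  ∑' k, (cantorDigit a z k : ℝ) * β (k + 1)

/-- The floors rank the words of length `n` lexicographically, and words whose ranks differ by `D`
have sums at least `D * β n` apart. Induction: the rank gap becomes `(a n - 1) * D` plus the digit
difference, and `a n * β (n + 1) ≤ β n`. -/
theorem floor_sub_floor_mul_le (h : IsEuclidean a β) (h2 : ∀ k, 2 ≤ a k) {y z : ℝ}
    (hy : y ∈ Set.Ico (0 : ℝ) 1) (hz : z ∈ Set.Ico (0 : ℝ) 1) (hyz : y ≤ z) (n : ℕ) :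
    ((⌊(wordCount a n : ℝ) * z⌋ - ⌊(wordCount a n : ℝ) * y⌋ : ℤ) : ℝ) * β n ≤
      ∑ k ∈ Finset.range n, (cantorDigit a z k : ℝ) * β (k + 1) -
      ∑ k ∈ Finset.range n, (cantorDigit a y k : ℝ) * β (k + 1) := by
  induction n with
  | zero => simp [wordCount, Int.floor_eq_zero_iff.2 hy, Int.floor_eq_zero_iff.2 hz]
  | succ n ih =>
    have hD : (0 : ℝ) ≤ ((⌊(wordCount a n : ℝ) * z⌋ - ⌊(wordCount a n : ℝ) * y⌋ : ℤ) : ℝ) := by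
      have : (wordCount a n : ℝ) * y ≤ wordCount a n * z := by gcongr
      exact_mod_cast sub_nonneg.2 (Int.floor_mono this)
    have cz := congrArg (Int.cast (R := ℝ)) (cantorDigit_cast h2 z n)
    have cy := congrArg (Int.cast (R := ℝ)) (cantorDigit_cast h2 y n)
    rw [Int.cast_natCast] at cz cy
    rw [Finset.sum_range_succ, Finset.sum_range_succ, cz, cy]
    have h1 := mul_le_mul_of_nonneg_left (h.mul_le n) hD
    have h3 := mul_nonneg hD (h.pos (n + 1)).le
    have h4 : ((a n - 1 : ℕ) : ℝ) = a n - 1 := by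
      rw [Nat.cast_sub (h.one_le n), Nat.cast_one]
    push_cast [h4] at *
    nlinarith

/-- One `β n` pays for rounding to floors, the other for the discarded tail of `y`. -/
theorem sub_le_of_le (h : IsEuclidean a β) (h2 : ∀ k, 2 ≤ a k) {y z : ℝ}
    (hy : y ∈ Set.Ico (0 : ℝ) 1) (hz : z ∈ Set.Ico (0 : ℝ) 1) (hyz : y ≤ z) (n : ℕ) :
    (z - y) * (wordCount a n * β n) ≤ |cantorPoint a β z - cantorPoint a β y| + 2 * β n := by
  have hp := h.pos n
  have hle : ∀ w, ∀ k, cantorDigit a w k ≤ a k := fun w k =>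
    (Nat.le_succ _).trans (cantorDigit_add_one_le h2 w k)
  have h1 := floor_sub_floor_mul_le h h2 hy hz hyz n
  have h3 := h.tail_lt n fun k _ => cantorDigit_add_one_le h2 y k
  have h4 : 0 ≤ ∑' k, (cantorDigit a z (k + n) : ℝ) * β (k + n + 1) :=
    tsum_nonneg fun k => h.term_nonneg _ _
  have h5 := le_abs_self (cantorPoint a β z - cantorPoint a β y)
  rw [cantorPoint, cantorPoint, h.tsum_eq_sum_add (hle z) n, h.tsum_eq_sum_add (hle y) n] at *
  have h6 := Int.lt_floor_add_one ((wordCount a n : ℝ) * z)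
  have h7 := Int.floor_le ((wordCount a n : ℝ) * y)
  push_cast at h1
  nlinarith

theorem abs_sub_mul_le (h : IsEuclidean a β) (h2 : ∀ k, 2 ≤ a k) {y z : ℝ}
    (hy : y ∈ Set.Ico (0 : ℝ) 1) (hz : z ∈ Set.Ico (0 : ℝ) 1) (n : ℕ) :
    |z - y| * (wordCount a n * β n) ≤ |cantorPoint a β z - cantorPoint a β y| + 2 * β n := by
  rcases le_total y z with hyz | hyz
  · rw [abs_of_nonneg (sub_nonneg.2 hyz)]
    exact sub_le_of_le h h2 hy hz hyz n
  · rw [abs_sub_comm z, abs_sub_comm (cantorPoint a β z), abs_of_nonneg (sub_nonneg.2 hyz)]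
    exact sub_le_of_le h h2 hz hy hyz n

theorem cantorPoint_mem (h : IsEuclidean a β) (h2 : ∀ k, 2 ≤ a k) (z : ℝ) :
    cantorPoint a β z ∈ Set.Ioo 0 (β 0) :=
  ⟨(h.pos 1).trans (h.lt_tsum
      (fun k => (Nat.le_succ _).trans (cantorDigit_add_one_le h2 z k)) (one_le_cantorDigit h2 z)),
    h.tsum_lt (cantorDigit_add_one_le h2 z)⟩

/-- The Cantor series digits of `z` depend Hölder continuously on the point they define. -/
theorem abs_sub_le_rpow (h : IsEuclidean a β) (h2 : ∀ k, 2 ≤ a k) {C s : ℝ} (hs0 : 0 < s)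
    (hs1 : s ≤ 1) (hC : ∀ n, 1 ≤ C * wordCount a n * β n ^ s) {y z : ℝ}
    (hy : y ∈ Set.Ico (0 : ℝ) 1) (hz : z ∈ Set.Ico (0 : ℝ) 1) :
    |z - y| ≤ 9 * C * |cantorPoint a β z - cantorPoint a β y| ^ s := by
  have hNpos : ∀ n, (0 : ℝ) < wordCount a n := fun n => by exact_mod_cast wordCount_pos h2 n
  have hβs : ∀ n, 0 < β n ^ s := fun n => Real.rpow_pos_of_pos (h.pos n) s
  have hC0 : 0 < C := by
    have h1 := hC 0
    have h3 := mul_pos (hNpos 0) (hβs 0)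
    by_contra! hc
    nlinarith
  set Δ := |cantorPoint a β z - cantorPoint a β y| with hΔ
  have key := abs_sub_mul_le h h2 hy hz
  have hlim := h.tendsto_zero h2
  -- For coinciding points no scale matches `Δ`, so `n → ∞` is used instead.
  rcases (abs_nonneg (cantorPoint a β z - cantorPoint a β y)).eq_or_lt with h0 | hpos
  · rw [← hΔ] at h0
    have hle : ∀ n, |z - y| ≤ 2 * C * β n ^ s := fun n => by
      have h1 := key n
      rw [← hΔ, ← h0] at h1
      have h3 : |z - y| * wordCount a n ≤ 2 :=
        le_of_mul_le_mul_right (by linarith) (h.pos n)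
      calc |z - y| = |z - y| * 1 := (mul_one _).symm
        _ ≤ |z - y| * (C * wordCount a n * β n ^ s) := by gcongr; exact hC n
        _ = (|z - y| * wordCount a n) * (C * β n ^ s) := by ring
        _ ≤ 2 * (C * β n ^ s) := by
          gcongr
          exact (mul_pos hC0 (hβs n)).le
        _ = _ := by ring
    have ht : Filter.Tendsto (fun n => 2 * C * β n ^ s) Filter.atTop (nhds 0) := by
      have := (hlim.rpow_const (p := s) (Or.inr hs0.le)).const_mul (2 * C)
      simpa [Real.zero_rpow hs0.ne'] using this
    have h1 : |z - y| ≤ 0 := ge_of_tendsto' ht hle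
    rw [← h0, Real.zero_rpow hs0.ne', mul_zero]
    exact h1
  · rw [← hΔ] at hpos
    have hΔ0 : Δ < β 0 := by
      have h1 := cantorPoint_mem h h2 z
      have h3 := cantorPoint_mem h h2 y
      rw [hΔ, abs_sub_lt_iff]
      constructor <;> linarith [h1.1, h1.2, h3.1, h3.2]
    have hex : ∃ n, β n < Δ := ((hlim.eventually (gt_mem_nhds hpos))).exists
    obtain ⟨n, hn, hn1⟩ : ∃ n, Δ ≤ β n ∧ β (n + 1) < Δ := by
      classical
      have hne : Nat.find hex ≠ 0 := fun h0 => by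
        have := Nat.find_spec hex
        rw [h0] at this
        linarith
      refine ⟨Nat.find hex - 1, not_lt.1 (Nat.find_min hex (by omega)), ?_⟩
      rw [Nat.sub_add_cancel (by omega)]
      exact Nat.find_spec hex
    have h1 := key (n + 1)
    have hb := h.pos n
    have ha : (2 : ℝ) ≤ a n := by exact_mod_cast h2 n
    have hw : (wordCount a (n + 1) : ℝ) = wordCount a n * (a n - 1) := by
      rw [wordCount_succ, Nat.cast_mul, Nat.cast_sub (h.one_le n), Nat.cast_one]
    -- `a n + 1 ≤ 3 * (a n - 1)` because `a n ≥ 2`. The other factor 3 in the constant 9 comes from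
    -- `Δ + 2 * β (n + 1) ≤ 3 * Δ`.
    have h3 : β n ≤ 3 * ((a n - 1) * β (n + 1)) := by
      have := h.le_add_one_mul n
      nlinarith [h.pos (n + 1)]
    have h4 : |z - y| * wordCount a n * β n ≤ 9 * Δ := by
      calc |z - y| * wordCount a n * β n
          ≤ |z - y| * wordCount a n * (3 * ((a n - 1) * β (n + 1))) := by gcongr
        _ = 3 * (|z - y| * (wordCount a (n + 1) * β (n + 1))) := by rw [hw]; ring
        _ ≤ 3 * (Δ + 2 * β (n + 1)) := by gcongr
        _ ≤ 9 * Δ := by linarith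
    have h5 : |z - y| * wordCount a n ≤ 9 * (Δ / β n) := by
      rw [← mul_div_assoc, le_div_iff₀ hb]; exact h4
    have h6 : Δ / β n ≤ Δ ^ s / β n ^ s := by
      rw [← Real.div_rpow hpos.le hb.le]
      calc Δ / β n = (Δ / β n) ^ (1 : ℝ) := (Real.rpow_one _).symm
        _ ≤ _ := Real.rpow_le_rpow_of_exponent_ge (by positivity) ((div_le_one hb).2 hn) hs1
    calc |z - y| = |z - y| * 1 := (mul_one _).symm
      _ ≤ |z - y| * (C * wordCount a n * β n ^ s) := by gcongr; exact hC n
      _ = (|z - y| * wordCount a n) * (C * β n ^ s) := by ring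
      _ ≤ (9 * (Δ ^ s / β n ^ s)) * (C * β n ^ s) :=
        mul_le_mul_of_nonneg_right (by linarith) (mul_pos hC0 (hβs n)).le
      _ = 9 * C * Δ ^ s := by
        have := (hβs n).ne'
        field_simp

theorem dimH_cantorPoint_image_pos (h : IsEuclidean a β) (h2 : ∀ k, 2 ≤ a k) {C s : ℝ}
    (hs0 : 0 < s) (hs1 : s ≤ 1) (hC : ∀ n, 1 ≤ C * wordCount a n * β n ^ s) :
    0 < dimH (cantorPoint a β '' Set.Ico (0 : ℝ) 1) := by
  have key := fun {y z : ℝ} => abs_sub_le_rpow h h2 hs0 hs1 hC (y := y) (z := z)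
  have hinj : Set.InjOn (cantorPoint a β) (Set.Ico (0 : ℝ) 1) := fun z hz y hy heq => by
    have := key hy hz
    rw [heq, sub_self, abs_zero, Real.zero_rpow hs0.ne', mul_zero] at this
    exact sub_eq_zero.1 (abs_nonpos_iff.1 this)
  set g := Function.invFunOn (cantorPoint a β) (Set.Ico (0 : ℝ) 1)
  have hg : Set.LeftInvOn g (cantorPoint a β) (Set.Ico (0 : ℝ) 1) := hinj.leftInvOn_invFunOn
  have hH : HolderOnWith (9 * C).toNNReal s.toNNReal g
      (cantorPoint a β '' Set.Ico (0 : ℝ) 1) := by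
    rintro _ ⟨z, hz, rfl⟩ _ ⟨y, hy, rfl⟩
    rw [hg hz, hg hy, edist_dist, edist_dist, Real.dist_eq, Real.dist_eq,
      Real.coe_toNNReal _ hs0.le, ENNReal.ofReal_rpow_of_nonneg (abs_nonneg _) hs0.le,
      ← ENNReal.ofReal.eq_1, ← ENNReal.ofReal_mul' (by positivity)]
    exact ENNReal.ofReal_le_ofReal (key hy hz)
  have hdim := hH.dimH_image_le (Real.toNNReal_pos.2 hs0)
  rw [hg.image_image, Real.dimH_of_nonempty_interior (by simp)] at hdim
  rw [pos_iff_ne_zero]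
  intro h0
  rw [h0, ENNReal.zero_div] at hdim
  simp at hdim

theorem exists_holder_const (h : IsEuclidean a β) (h2 : ∀ k, 2 ≤ a k) {c : ℝ} (hc : 0 < c)
    (hlog : ∀ᶠ n in Filter.atTop, c * ∑ k ∈ Finset.range n, Real.log (a k + 1) ≤
      ∑ k ∈ Finset.range n, Real.log (a k - 1)) :
    ∃ C s : ℝ, 0 < s ∧ s ≤ 1 ∧ ∀ n, 1 ≤ C * wordCount a n * β n ^ s := by
  have ha : ∀ k, (2 : ℝ) ≤ a k := fun k => by exact_mod_cast h2 k
  have hs0 : 0 < min c 1 := lt_min hc one_pos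
  have hN : ∀ n, ∑ k ∈ Finset.range n, Real.log (a k - 1) = Real.log (wordCount a n) := fun n => by
    rw [wordCount, Nat.cast_prod, Real.log_prod]
    · refine Finset.sum_congr rfl fun k _ => ?_
      rw [Nat.cast_sub (h.one_le k), Nat.cast_one]
    · intro k _
      have := h2 k
      exact_mod_cast (by omega)
  -- Iterating `β k ≤ (a k + 1) * β (k + 1)` gives `β n ≥ β 0 / ∏ (a k + 1)`.
  have hB : ∀ n, Real.log (β 0) - ∑ k ∈ Finset.range n, Real.log (a k + 1) ≤ Real.log (β n) := by
    intro n
    induction n with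
    | zero => simp
    | succ n ih =>
      have h1 := Real.log_le_log (h.pos n) (h.le_add_one_mul n)
      rw [Real.log_mul (by linarith [ha n]) (h.pos _).ne'] at h1
      rw [Finset.sum_range_succ]
      linarith
  obtain ⟨m, hm⟩ := Filter.eventually_atTop.1 hlog
  set s := min c 1 with hs
  have hpow : ∀ n, 0 < β n ^ s := fun n => Real.rpow_pos_of_pos (h.pos n) s
  have hNpos : ∀ n, (1 : ℝ) ≤ wordCount a n := fun n => by exact_mod_cast wordCount_pos h2 n
  -- Below the threshold `m`, monotonicity of `β` and `wordCount a n ≥ 1` suffice; beyond it, `s ≤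
  -- c` gives `wordCount a n * β n ^ s ≥ β 0 ^ s`.
  refine ⟨(β m ^ s)⁻¹, s, hs0, min_le_right _ _, fun n => ?_⟩
  rw [mul_assoc, ← div_eq_inv_mul, one_le_div (hpow m)]
  rcases le_total n m with hnm | hnm
  · calc β m ^ s ≤ 1 * β n ^ s := by
          rw [one_mul]
          exact Real.rpow_le_rpow (h.pos m).le (h.antitone hnm) hs0.le
      _ ≤ _ := mul_le_mul_of_nonneg_right (hNpos n) (hpow n).le
  · calc β m ^ s ≤ β 0 ^ s := Real.rpow_le_rpow (h.pos m).le (h.antitone (Nat.zero_le m)) hs0.le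
      _ ≤ _ := by
        have hT : 0 ≤ ∑ k ∈ Finset.range n, Real.log (a k + 1) :=
          Finset.sum_nonneg fun k _ => Real.log_nonneg (by linarith [ha k])
        have h1 := hm n hnm
        have h3 := mul_le_mul_of_nonneg_right (min_le_left c 1) hT
        have h4 := mul_le_mul_of_nonneg_left (hB n) hs0.le
        have hNn : (0 : ℝ) < wordCount a n := by linarith [hNpos n]
        rw [hN] at h1
        rw [← Real.log_le_log_iff (hpow 0) (mul_pos hNn (hpow n)),
          Real.log_mul hNn.ne' (hpow n).ne', Real.log_rpow (h.pos 0), Real.log_rpow (h.pos n)]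
        linarith

end Cantor

/-! ### Gauss map remainders and the bases -/

section ContinuedFraction

/-- The `n`-th complete remainder of the continued fraction of `α ∈ (0, 1)`: the `n`-th iterate of
`α` under the Gauss map. -/
noncomputable def remainder (α : ℝ) (n : ℕ) : ℝ := (fun x : ℝ => Int.fract x⁻¹)^[n] α

/-- The partial quotients as natural numbers, indexed from `0`. -/
noncomputable def quot (α : ℝ) (n : ℕ) : ℕ := ⌊(remainder α n)⁻¹⌋₊

/-- The sequence `base α` extended to the index `0` by the value `1`. -/
noncomputable def extBase (α : ℝ) : ℕ → ℝ
  | 0 => 1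
  | n + 1 => base α (n + 1)

variable {α : ℝ}

theorem remainder_succ (α : ℝ) (n : ℕ) : remainder α (n + 1) = Int.fract (remainder α n)⁻¹ :=
  Function.iterate_succ_apply' _ _ _

theorem irrational_fract {x : ℝ} (hx : Irrational x) : Irrational (Int.fract x) :=
  hx.sub_intCast _

theorem irrational_remainder (hirr : Irrational α) (n : ℕ) : Irrational (remainder α n) := by
  induction n with
  | zero => exact hirr
  | succ n ih => rw [remainder_succ]; exact irrational_fract ih.inv

theorem remainder_mem (hα : α ∈ Set.Ioo (0 : ℝ) 1) (hirr : Irrational α) (n : ℕ) :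
    remainder α n ∈ Set.Ioo (0 : ℝ) 1 := by
  cases n with
  | zero => exact hα
  | succ n =>
    have h := (irrational_remainder hirr (n + 1)).ne_zero
    rw [remainder_succ] at h ⊢
    exact ⟨(Int.fract_nonneg _).lt_of_ne' h, Int.fract_lt_one _⟩

theorem inv_remainder (hα : α ∈ Set.Ioo (0 : ℝ) 1) (hirr : Irrational α) (n : ℕ) :
    (remainder α n)⁻¹ = quot α n + remainder α (n + 1) := by
  have h : 0 ≤ (remainder α n)⁻¹ := inv_nonneg.2 (remainder_mem hα hirr n).1.le
  rw [remainder_succ, quot, natCast_floor_eq_intCast_floor h, Int.floor_add_fract]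

theorem of_s_get? {v : ℝ} (hv : Irrational v) (n : ℕ) :
    (GenContFract.of v).s.get? n = some ⟨1, ⌊(remainder (Int.fract v) n)⁻¹⌋⟩ := by
  induction n generalizing v with
  | zero => exact GenContFract.of_s_head (irrational_fract hv).ne_zero
  | succ n ih =>
    rw [GenContFract.of_s_succ, ih (irrational_fract hv).inv, remainder, remainder,
      Function.iterate_succ_apply]

theorem of_s_get?_eq_quot (hα : α ∈ Set.Ioo (0 : ℝ) 1) (hirr : Irrational α) (n : ℕ) :
    (GenContFract.of α).s.get? n = some ⟨1, quot α n⟩ := by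
  have h : 0 ≤ (remainder α n)⁻¹ := inv_nonneg.2 (remainder_mem hα hirr n).1.le
  rw [of_s_get? hirr, Int.fract_eq_self.2 ⟨hα.1.le, hα.2⟩, quot, natCast_floor_eq_intCast_floor h]

theorem partialQuotient_succ (hα : α ∈ Set.Ioo (0 : ℝ) 1) (hirr : Irrational α) (n : ℕ) :
    partialQuotient α (n + 1) = quot α n := by
  rw [partialQuotient, Nat.add_sub_cancel,
    GenContFract.partDen_eq_s_b (of_s_get?_eq_quot hα hirr n)]
  rfl

/-- With `θ` the signed error and `r` the remainder, the recurrence and the induction hypothesis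
turn the next error into `(a - r⁻¹) * θ`, and `r⁻¹ - a` is the next remainder. -/
theorem convDen_mul_sub_convNum (hα : α ∈ Set.Ioo (0 : ℝ) 1) (hirr : Irrational α) (n : ℕ) :
    convDen α (n + 2) * α - convNum α (n + 2) =
      -remainder α (n + 1) * (convDen α (n + 1) * α - convNum α (n + 1)) := by
  have hget := of_s_get?_eq_quot hα hirr
  have hinv := inv_remainder hα hirr
  simp only [convDen, convNum, Nat.add_sub_cancel, show ∀ n : ℕ, n + 2 - 1 = n + 1 from fun _ => rfl]
  induction n with
  | zero =>
    have h0 : (⌊α⌋ : ℝ) = 0 := by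
      rw [Int.floor_eq_zero_iff.2 ⟨hα.1.le, hα.2⟩, Int.cast_zero]
    rw [GenContFract.first_num_eq (hget 0), GenContFract.first_den_eq (hget 0),
      GenContFract.zeroth_num_eq_h, GenContFract.zeroth_den_eq_one, GenContFract.of_h_eq_floor, h0]
    have h1 : α⁻¹ = quot α 0 + remainder α 1 := hinv 0
    have h2 : (quot α 0 : ℝ) = α⁻¹ - remainder α 1 := by linarith
    have h3 : α⁻¹ * α = 1 := inv_mul_cancel₀ hα.1.ne'
    dsimp only
    rw [h2]
    linear_combination h3
  | succ n ih =>
    rw [GenContFract.dens_recurrence (hget (n + 1)) rfl rfl,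
      GenContFract.nums_recurrence (hget (n + 1)) rfl rfl]
    have h2 : (quot α (n + 1) : ℝ) = (remainder α (n + 1))⁻¹ - remainder α (n + 2) := by
      linarith [hinv (n + 1)]
    have h3 : (remainder α (n + 1))⁻¹ * remainder α (n + 1) = 1 :=
      inv_mul_cancel₀ (remainder_mem hα hirr (n + 1)).1.ne'
    dsimp only
    rw [h2]
    set D := (GenContFract.of α).dens
    set P := (GenContFract.of α).nums
    linear_combination (remainder α (n + 1))⁻¹ * ih - (D n * α - P n) * h3

theorem extBase_succ (hα : α ∈ Set.Ioo (0 : ℝ) 1) (hirr : Irrational α) (n : ℕ) :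
    extBase α (n + 1) = remainder α n * extBase α n := by
  cases n with
  | zero =>
    have h0 : (⌊α⌋ : ℝ) = 0 := by
      rw [Int.floor_eq_zero_iff.2 ⟨hα.1.le, hα.2⟩, Int.cast_zero]
    simp [extBase, base, convDen, convNum, remainder, h0, abs_of_pos hα.1]
  | succ n =>
    rw [extBase, extBase, base, convDen_mul_sub_convNum hα hirr, abs_mul, abs_neg,
      abs_of_pos (remainder_mem hα hirr _).1, base]

theorem extBase_pos (hα : α ∈ Set.Ioo (0 : ℝ) 1) (hirr : Irrational α) (n : ℕ) :
    0 < extBase α n := by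
  induction n with
  | zero => exact one_pos
  | succ n ih =>
    rw [extBase_succ hα hirr]
    exact mul_pos (remainder_mem hα hirr n).1 ih

theorem isEuclidean_extBase (hα : α ∈ Set.Ioo (0 : ℝ) 1) (hirr : Irrational α) :
    IsEuclidean (quot α) (extBase α) where
  one_le k := by
    have h := remainder_mem hα hirr k
    rw [quot, Nat.one_le_floor_iff]
    exact (one_le_inv₀ h.1).2 h.2.le
  pos := extBase_pos hα hirr
  rec_eq k := by
    have h3 : (remainder α k)⁻¹ * remainder α k = 1 :=
      inv_mul_cancel₀ (remainder_mem hα hirr k).1.ne'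
    have h2 := inv_remainder hα hirr k
    rw [extBase_succ hα hirr (k + 1), extBase_succ hα hirr k]
    linear_combination -extBase α k * h3 + remainder α k * extBase α k * h2

theorem two_le_quot (hα : α ∈ Set.Ioo (0 : ℝ) 1) (hirr : Irrational α) (hn₀ : lastOne α < ⊤)
    {k : ℕ} (hk : (lastOne α).toNat ≤ k) : 2 ≤ quot α k := by
  have h1 := (isEuclidean_extBase hα hirr).one_le k
  have hne : quot α k ≠ 1 := fun h => by
    -- `quot α k` is the partial quotient of index `k + 1`, already beyond `n₀` when `k = n₀`.
    have hmem : k + 1 ∈ {n : ℕ | 1 ≤ n ∧ partialQuotient α n = 1} :=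
      ⟨by omega, by rw [partialQuotient_succ hα hirr, h, Nat.cast_one]⟩
    have hle : ((k + 1 : ℕ) : ℕ∞) ≤ lastOne α :=
      le_iSup₂ (f := fun (n : ℕ) (_ : n ∈ {n : ℕ | 1 ≤ n ∧ partialQuotient α n = 1}) =>
        (n : ℕ∞)) (k + 1) hmem
    rw [← ENat.natCast_toNat hn₀.ne, Nat.cast_le] at hle
    omega
  omega

/-- Points with vanishing digits up to `N` and non-extremal digits afterwards have a unique
expansion. -/
theorem cantorPoint_mem_uniqueSet (hα : α ∈ Set.Ioo (0 : ℝ) 1) (hirr : Irrational α) {N : ℕ}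
    (h2 : ∀ k, 2 ≤ quot α (k + N)) (z : ℝ) :
    cantorPoint (fun k => quot α (k + N)) (fun k => extBase α (k + N)) z ∈ uniqueSet α := by
  have h := isEuclidean_extBase hα hirr
  set A := fun k => quot α (k + N)
  have hmem := cantorPoint_mem (h.shift N) h2 z
  set x := cantorPoint A (fun k => extBase α (k + N)) z with hx
  set d : ℕ → ℕ := fun k => if k < N then 0 else cantorDigit A z (k - N) with hd
  have hd0 : ∀ k < N, d k = 0 := fun k hk => if_pos hk
  have hdN : ∀ k, d (k + N) = cantorDigit A z k := fun k => by simp [hd]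
  have hd1 : ∀ k, N ≤ k → 1 ≤ d k ∧ d k + 1 ≤ quot α k := fun k hk => by
    obtain ⟨j, rfl⟩ := Nat.exists_eq_add_of_le' hk
    rw [hdN]
    exact ⟨one_le_cantorDigit h2 z j, cantorDigit_add_one_le h2 z j⟩
  have hda : ∀ k, d k ≤ quot α k := fun k => by
    rcases lt_or_ge k N with hk | hk
    · simp [hd0 k hk]
    · exact (Nat.le_succ _).trans (hd1 k hk).2
  have hdx : ∑' k, (d k : ℝ) * extBase α (k + 1) = x := by
    rw [h.tsum_eq_sum_add hda N,
      Finset.sum_eq_zero fun k hk => by simp [hd0 k (Finset.mem_range.1 hk)], zero_add, hx,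
      cantorPoint]
    simp only [hdN, add_right_comm _ 1 N]
  have hrep : ∀ e : ℕ → ℕ, Represents α e x ↔ (∀ k, e k ≤ quot α k) ∧
      HasSum (fun k => (e k : ℝ) * extBase α (k + 1)) x := fun e => by
    simp only [Represents, digitSpace, Set.mem_ofPred_eq, partialQuotient_succ hα hirr,
      Nat.cast_le, extBase]
  refine ⟨⟨hmem.1, hmem.2.trans_le ?_⟩, d, (hrep d).2 ⟨hda, ?_⟩, fun e he => ?_⟩
  · exact h.antitone (Nat.zero_le (0 + N))
  · rw [← hdx]
    exact (h.summable hda).hasSum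
  · obtain ⟨he1, he2⟩ := (hrep e).1 he
    exact h.digits_unique_of_mem_Icc N hd0 hd1 he1 (by rw [hdx, he2.tsum_eq])

end ContinuedFraction

/-! ### Transfer of the liminf hypothesis -/

theorem sum_Icc_add_eq_sum_range (f : ℕ → ℝ) (N m : ℕ) :
    ∑ k ∈ Finset.Icc (N + 1) (m + N), f k = ∑ k ∈ Finset.range m, f (k + N + 1) := by
  simpa only [Finset.range_eq_Ico, ← Finset.Ico_add_one_right_eq_Icc, add_assoc, zero_add] using
    (Finset.sum_Ico_add' f 0 m (N + 1)).symm

end RotationalExpansion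

theorem mainTheorem6 (α : ℝ) (hα : α ∈ Set.Ioo (0 : ℝ) 1) (hirr : Irrational α)
    (hn₀ : RotationalExpansion.lastOne α < ⊤)
    (hlim : 0 < Filter.liminf (fun n : ℕ =>
      (∑ k ∈ Finset.Icc ((RotationalExpansion.lastOne α).toNat + 1) n,
          Real.log (RotationalExpansion.partialQuotient α k - 1)) /
        (∑ k ∈ Finset.Icc ((RotationalExpansion.lastOne α).toNat + 1) n,
          Real.log (RotationalExpansion.partialQuotient α k + 1))) Filter.atTop) :
    0 < dimH (RotationalExpansion.uniqueSet α) := by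
  set N := (RotationalExpansion.lastOne α).toNat
  have h := (RotationalExpansion.isEuclidean_extBase hα hirr).shift N
  have h2 : ∀ k, 2 ≤ RotationalExpansion.quot α (k + N) := fun k =>
    RotationalExpansion.two_le_quot hα hirr hn₀ (Nat.le_add_left N k)
  have hq : ∀ k, N + 1 ≤ k → 2 ≤ RotationalExpansion.partialQuotient α k := fun k hk => by
    obtain ⟨j, rfl⟩ := Nat.exists_eq_add_of_le' hk
    rw [← add_assoc, RotationalExpansion.partialQuotient_succ hα hirr]
    exact_mod_cast h2 j
  have hS : ∀ n, 0 ≤ ∑ k ∈ Finset.Icc (N + 1) n,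
      Real.log (RotationalExpansion.partialQuotient α k - 1) := fun n =>
    Finset.sum_nonneg fun k hk => Real.log_nonneg (by linarith [hq k (Finset.mem_Icc.1 hk).1])
  have hT : ∀ n, 0 ≤ ∑ k ∈ Finset.Icc (N + 1) n,
      Real.log (RotationalExpansion.partialQuotient α k + 1) := fun n =>
    Finset.sum_nonneg fun k hk => Real.log_nonneg (by linarith [hq k (Finset.mem_Icc.1 hk).1])
  obtain ⟨c, hc, hcl⟩ := exists_between hlim
  have hev := Filter.eventually_lt_of_lt_liminf hcl
    ⟨0, Filter.eventually_map.2 (Filter.Eventually.of_forall fun n => div_nonneg (hS n) (hT n))⟩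
  obtain ⟨C, s, hs0, hs1, hC⟩ := RotationalExpansion.exists_holder_const h h2 hc (by
    filter_upwards [(Filter.tendsto_add_atTop_nat N).eventually hev] with m hm
    -- A zero denominator would make the quotient `0`, contradicting that it exceeds `c > 0`.
    have hTpos := (hT (m + N)).lt_of_ne fun h0 => by
      rw [← h0, div_zero] at hm
      exact hm.not_gt hc
    rw [lt_div_iff₀ hTpos, RotationalExpansion.sum_Icc_add_eq_sum_range,
      RotationalExpansion.sum_Icc_add_eq_sum_range] at hm
    simpa only [RotationalExpansion.partialQuotient_succ hα hirr] using hm.le)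
  refine (RotationalExpansion.dimH_cantorPoint_image_pos h h2 hs0 hs1 hC).trans_le (dimH_mono ?_)
  rintro _ ⟨z, -, rfl⟩
  exact RotationalExpansion.cantorPoint_mem_uniqueSet hα hirr h2 z
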